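/- Let $m\in\mathbb{N}$ and let $(M,g)$ be a connected $m$-dimensional $C^\infty$ Riemannian manifold with Riemannian distance $d$. Let $\phi=(\phi(x),\,x\in M)$ be a real-valued random field on a probability space $(\Omega,\mathcal{A},P)$, i.e. each $\phi(x)$ is a real random variable. A modification of $\phi$ is a real-valued random field $\psi=(\psi(x),\,x\in M)$ on the same probability space such that $P(\psi(x)=\phi(x))=1$ for every $x\in M$. The right-hand sides of the bounds below are read as $0$ when $x=y$. (a) If there exist $\rho\in(0,1]$, $l\ge 1$, $\kappa\ge m$, $\nu>l+1$ and $K>0$ such that $$\mathbb{E}\bigl(|\phi(x)-\phi(y)|^l\bigr)\le K\,\log_2\bigl(d(x,y)^{-1}\bigr)^{-\nu}\,d(x,y)^{\kappa}$$ for all $x,y\in M$ with $d(x,y)<\rho$, then $\phi$ has a modification $\psi$ which is locally uniformly continuous: for every $\omega\in\Omega$, every $z\in M$ has a neighbourhood on which $x\mapsto\psi(x,\omega)$ is uniformly continuous. (b) If there exist $\rho\in(0,1]$, $l\ge 1$, $\gamma\in(0,1)$, $\alpha>1$ and $K>0$ such that $$\mathbb{E}\bigl(|\phi(x)-\phi(y)|^l\bigr)\le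 K\,\log_2\bigl(d(x,y)^{-1}\bigr)^{-\alpha}\,d(x,y)^{m+l\gamma}$$ for all $x,y\in M$ with $d(x,y)<\rho$, then $\phi$ has a modification $\psi$ whose sample paths are locally Hölder continuous of order $\gamma$: for every $z\in M$ there is a constant $C_z$ such that for every $\omega\in\Omega$ there is a neighbourhood $V(\omega)$ of $z$ with $$|\psi(x,\omega)-\psi(y,\omega)|\le C_z\,d(x,y)^{\gamma}\qquad\text{for all }x,y\in V(\omega).$$ -/

import Mathlib

open MeasureTheory Bundle
open scoped Topology Manifold ContDiff

/-- A real-valued random field `φ = (φ(x), x ∈ M)`: every `φ(x)` is a random variable. -/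
def IsRandomField {M Ω : Type*} [MeasurableSpace Ω] (φ : M → Ω → ℝ) : Prop :=
  ∀ x, Measurable (φ x)

/-- `ψ` is a modification of `φ`: it is a random field, and for each fixed `x` one has
`ψ(x) = φ(x)` outside a `P`-null set (which may depend on `x`). -/
structure IsModification {M Ω : Type*} [MeasurableSpace Ω] (P : Measure Ω)
    (ψ φ : M → Ω → ℝ) : Prop where
  isRandomField : IsRandomField ψ
  ae_eq : ∀ x, ∀ᵐ w ∂P, ψ x w = φ x w

/-- Every sample path is locally uniformly continuous: each point has a neighbourhood on which
the path is uniformly continuous. -/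
def HasLocallyUniformlyContinuousPaths {M Ω : Type*} [MetricSpace M] (ψ : M → Ω → ℝ) : Prop :=
  ∀ w, ∀ z, ∃ V ∈ 𝓝 z, UniformContinuousOn (fun x ↦ ψ x w) V

/-- Every sample path is locally Hölder continuous of order `γ`: each point `z` has a
neighbourhood `V`, depending on the path, on which `|ψ(x) - ψ(y)| ≤ C d(x,y) ^ γ`.
The constant `C` is deterministic (it may depend on `z`). -/
def HasLocallyHolderPaths {M Ω : Type*} [MetricSpace M] (γ : ℝ) (ψ : M → Ω → ℝ) : Prop :=
  ∀ z, ∃ C : ℝ, ∀ w, ∃ V ∈ 𝓝 z, ∀ x ∈ V, ∀ y ∈ V, |ψ x w - ψ y w| ≤ C * dist x y ^ γ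

/-- The moment bound `E|φ(x) - φ(y)|^l ≤ K log₂(1/d(x,y))^{-ν} d(x,y)^κ` for all `x, y` with
`d(x,y) < ρ`. The expectation is a Lebesgue integral with values in `[0, ∞]`, so finiteness is
part of the bound; for `x = y` both sides are `0`. -/
def MomentBound {M Ω : Type*} [MetricSpace M] [MeasurableSpace Ω] (P : Measure Ω)
    (φ : M → Ω → ℝ) (ρ l K ν κ : ℝ) : Prop :=
  ∀ x y : M, dist x y < ρ →
    ∫⁻ w, ENNReal.ofReal (|φ x w - φ y w| ^ l) ∂P ≤
      ENNReal.ofReal (K * Real.logb 2 (dist x y)⁻¹ ^ (-ν) * dist x y ^ κ)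

/-! This is the Kolmogorov–Chentsov argument, run in charts. Near each point a chart is bi-Lipschitz
for the Riemannian distance, so the field can be pulled back to the unit cube of `ℝ^m` with the
moment bound intact up to constants (`exists_unitCube_chart`, `MomentBound.exists_le_of_dist_le`).

On the grid of mesh `2⁻ⁿ` there are at most `(3 * 2^n)^m` neighbouring pairs. By Markov, some pair
differs by more than `ε n` with probability at most a constant times `2^(nm) n^(-ν) 2^(-nκ) / (ε
n)^l`. If `2^(-n(κ-m)) ≤ (ε n)^l n^β` with `β + 1 < ν`, these bounds are summable. Borel–Cantelli
and chaining then give, from a random level on, the deterministic modulus `ε n + 2 ∑_{k>n} ε k` at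
scale `2⁻ⁿ` (`exists_modification_unitCube`). Fatou's lemma identifies the chained limit with the
field almost surely.

Part (a) takes `ε n = n^(-a)` with `a > 1` and `a l + 1 < ν`, possible because `ν > l + 1`. Part (b)
takes `ε n = 2^(-nγ)`, `β = 0`; only the starting level is random, so the Hölder constant is not.

A connected manifold with a metric is second countable, so countably many local modifications
suffice; they agree off one null event and glue (`exists_isModification_of_local`). -/

/-! ### Charts are bi-Lipschitz for the Riemannian distance -/

section RiemannianChart

open Set Filter Metric Manifold
open scoped NNReal ENNReal

variable {E : Type*} [NormedAddCommGroup E] [NormedSpace ℝ E]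
  {H : Type*} [TopologicalSpace H] (I : ModelWithCorners ℝ E H)
  {M : Type*}

attribute [local instance] normedAddCommGroupTangentSpaceVectorSpace
attribute [local instance] normedSpaceTangentSpaceVectorSpace

/-- The inverse of the extended chart at `x` is Lipschitz near the image of `x`, for the
Riemannian distance. -/
lemma exists_riemannianEDist_le_edist_extChartAt [TopologicalSpace M] [ChartedSpace H M]
    [RiemannianBundle (fun x : M ↦ TangentSpace I x)] [IsManifold I 1 M]
    [IsContinuousRiemannianBundle E (fun x : M ↦ TangentSpace I x)] (x : M) :
    ∃ C : ℝ≥0, ∃ s ∈ 𝓝 x, ∀ y ∈ s, ∀ z ∈ s,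
      riemannianEDist I y z ≤ C * edist (extChartAt I x y) (extChartAt I x z) := by
  rcases eventually_enorm_mfderivWithin_symm_extChartAt_lt I x with ⟨C, -, hC⟩
  obtain ⟨S, hS, hC⟩ := hC.exists_mem
  obtain ⟨r, r_pos, hr⟩ : ∃ r > 0,
      ball (extChartAt I x x) r ∩ range I ⊆ (extChartAt I x).target ∩ S :=
    mem_nhdsWithin_iff.1 (inter_mem (extChartAt_target_mem_nhdsWithin x) hS)
  have A : (extChartAt I x) ⁻¹' (ball (extChartAt I x x) r ∩ range I) ∈ 𝓝 x := by
    apply extChartAt_preimage_mem_nhds_of_mem_nhdsWithin (by simp)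
    rw [inter_comm]
    exact inter_mem_nhdsWithin _ (ball_mem_nhds _ r_pos)
  refine ⟨C, _, inter_mem A (chart_source_mem_nhds H x), ?_⟩
  rintro y ⟨hy, h'y⟩ z ⟨hz, h'z⟩
  -- The competitor curve is the chart preimage of a straight segment, which stays in the region of
  -- bounded derivative because `ball ∩ range I` is convex.
  let η := ContinuousAffineMap.lineMap (R := ℝ) (extChartAt I x y) (extChartAt I x z)
  set γ := (extChartAt I x).symm ∘ η
  have hη : Icc 0 1 ⊆ ⇑η ⁻¹' ((extChartAt I x).target ∩ S) := by
    simp only [← image_subset_iff, ContinuousAffineMap.coe_lineMap_eq,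
     ← segment_eq_image_lineMap, η]
    exact Subset.trans (((convex_ball _ _).inter I.convex_range).segment_subset hy hz) hr
  simp only [preimage_inter, subset_inter_iff] at hη
  have η_smooth : CMDiff[Icc 0 1] 1 η := by
    apply ContMDiff.contMDiffOn
    rw [contMDiff_iff_contDiff]
    exact ContinuousAffineMap.contDiff _
  have : riemannianEDist I y z ≤ pathELength I γ 0 1 := by
    apply riemannianEDist_le_pathELength _ _ _ zero_le_one
    · exact (contMDiffOn_extChartAt_symm x).comp η_smooth hη.1
    · simp [γ, η, ContinuousAffineMap.coe_lineMap_eq, h'y]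
    · simp [γ, η, ContinuousAffineMap.coe_lineMap_eq, h'z]
  apply this.trans
  rw [← lintegral_fderiv_lineMap_eq_edist, pathELength_eq_lintegral_mfderivWithin_Icc,
    ← lintegral_const_mul' _ _ ENNReal.coe_ne_top]
  apply setLIntegral_mono' measurableSet_Icc (fun t ht ↦ ?_)
  have : mfderiv[Icc 0 1] γ t =
      (mfderiv[range I] (extChartAt I x).symm (η t)) ∘L (mfderiv[Icc 0 1] η t) := by
    apply mfderivWithin_comp
    · exact mdifferentiableWithinAt_extChartAt_symm (hη.1 ht)
    · exact η_smooth.mdifferentiableOn one_ne_zero t ht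
    · exact hη.1.trans (preimage_mono (extChartAt_target_subset_range x))
    · rw [uniqueMDiffWithinAt_iff_uniqueDiffWithinAt]
      exact uniqueDiffOn_Icc zero_lt_one t ht
  have : mfderiv[Icc 0 1] γ t 1 =
      (mfderiv[range I] (extChartAt I x).symm (η t)) (mfderiv[Icc 0 1] η t 1) := congr($this 1)
  rw [this]
  apply (ContinuousLinearMap.le_opENorm _ _).trans
  gcongr
  · exact (hC _ (hη.2 ht)).le
  · simp only [mfderivWithin_eq_fderivWithin]
    exact le_of_eq rfl

/-- The extended chart at `x` is Lipschitz near `x`. -/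
lemma exists_edist_extChartAt_le_edist [MetricSpace M] [ChartedSpace H M]
    [RiemannianBundle (fun x : M ↦ TangentSpace I x)] [IsManifold I 1 M]
    [IsContinuousRiemannianBundle E (fun x : M ↦ TangentSpace I x)] [IsRiemannianManifold I M]
    (x : M) :
    ∃ C : ℝ≥0, ∃ s ∈ 𝓝 x, ∀ y ∈ s, ∀ z ∈ s,
      edist (extChartAt I x y) (extChartAt I x z) ≤ C * edist y z := by
  rcases eventually_enorm_mfderiv_extChartAt_lt I x with ⟨C, C_pos, hC⟩
  obtain ⟨S, hS, hC⟩ := hC.exists_mem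
  obtain ⟨c, c_pos, hc⟩ := EMetric.mem_nhds_iff.1
    (inter_mem hS (chart_source_mem_nhds H x))
  have hc3 : c / 3 + (c / 3 + c / 3) = c := by
    rw [← add_assoc, ENNReal.add_thirds]
  -- A curve of length below `2c/3` starting within `c/3` of `x` cannot leave the `c`-ball, where
  -- the chart is defined and its derivative bounded.
  refine ⟨C, eball x (c / 3), eball_mem_nhds _ (ENNReal.div_pos c_pos.ne' (by simp)), ?_⟩
  intro y hy z hz
  -- The distance is an infimum that need not be attained, so the bound is proved for every slightly
  -- larger `r`, which then decreases to it.
  suffices h : ∀ r, edist y z < r → r ≤ c / 3 + c / 3 →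
      edist (extChartAt I x y) (extChartAt I x z) ≤ C * r by
    have hyz : edist y z < c / 3 + c / 3 :=
      (edist_triangle_right y z x).trans_lt (ENNReal.add_lt_add hy hz)
    by_contra! hlt
    rw [mul_comm, ← ENNReal.lt_div_iff_mul_lt (.inl (by simpa using C_pos.ne')) (.inl (by simp))]
      at hlt
    obtain ⟨r, hr, hr'⟩ := exists_between (lt_min hlt hyz)
    refine (h r hr (hr'.le.trans (min_le_right _ _))).not_gt ?_
    rw [mul_comm, ← ENNReal.lt_div_iff_mul_lt (.inl (by simpa using C_pos.ne')) (.inl (by simp))]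
    exact hr'.trans_le (min_le_left _ _)
  intro r hr hrc
  rw [IsRiemannianManifold.out (I := I)] at hr
  rcases exists_lt_of_riemannianEDist_lt hr
    with ⟨γ, hγy, hγz, γ_smooth, hγ⟩
  have hmem : ∀ t ∈ Icc (0 : ℝ) 1, γ t ∈ S ∩ (chartAt H x).source := by
    intro t ht
    apply hc
    have h1 : edist y (γ t) < c / 3 + c / 3 := by
      rw [IsRiemannianManifold.out (I := I)]
      calc riemannianEDist I y (γ t) ≤ pathELength I γ 0 t :=
            riemannianEDist_le_pathELength
              (γ_smooth.mono (Icc_subset_Icc_right ht.2)) hγy rfl ht.1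
        _ ≤ pathELength I γ 0 1 := pathELength_mono le_rfl ht.2
        _ < r := hγ
        _ ≤ _ := hrc
    rw [mem_eball]
    calc edist (γ t) x ≤ edist y x + edist y (γ t) := by
          rw [add_comm, edist_comm y (γ t)]; exact edist_triangle _ _ _
      _ < c / 3 + (c / 3 + c / 3) := ENNReal.add_lt_add hy h1
      _ = c := hc3
  let γ' := extChartAt I x ∘ γ
  have hγ' : CMDiff[Icc 0 1] 1 γ' :=
    contMDiffOn_extChartAt.comp (I' := I) (t := (chartAt H x).source)
      γ_smooth (fun t' ht' ↦ (hmem t' ht').2)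
  calc edist (extChartAt I x y) (extChartAt I x z)
      = ‖γ' 1 - γ' 0‖ₑ := by rw [edist_comm, edist_eq_enorm_sub]; simp [γ', hγy, hγz]
    _ ≤ ∫⁻ t' in Icc 0 1, ‖derivWithin γ' (Icc 0 1) t'‖ₑ := by
      apply enorm_sub_le_lintegral_derivWithin_Icc_of_contDiffOn_Icc _ zero_le_one
      rwa [← contMDiffOn_iff_contDiffOn]
    _ = ∫⁻ t' in Icc 0 1, ‖mfderiv[Icc 0 1] γ' t' 1‖ₑ := by
      simp_rw [← fderivWithin_derivWithin, mfderivWithin_eq_fderivWithin]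
      rfl
    _ ≤ ∫⁻ t' in Icc 0 1, C * ‖mfderiv[Icc 0 1] γ t' 1‖ₑ := by
      apply setLIntegral_mono' measurableSet_Icc (fun t' ht' ↦ ?_)
      have : mfderiv[Icc 0 1] γ' t' =
          (mfderiv% (extChartAt I x) (γ t')) ∘L (mfderiv[Icc 0 1] γ t') := by
        apply mfderiv_comp_mfderivWithin
        · exact mdifferentiableAt_extChartAt (hmem t' ht').2
        · exact (γ_smooth.mdifferentiableOn one_ne_zero) _ ht'
        · rw [uniqueMDiffWithinAt_iff_uniqueDiffWithinAt]
          exact uniqueDiffOn_Icc zero_lt_one _ ht'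
      have : mfderiv[Icc 0 1] γ' t' 1 =
          (mfderiv% (extChartAt I x) (γ t')) (mfderiv[Icc 0 1] γ t' 1) :=
        congr($this 1)
      rw [this]
      apply (ContinuousLinearMap.le_opENorm _ _).trans
      gcongr
      exact (hC _ (hmem t' ht').1).le
    _ = C * pathELength I γ 0 1 := by
      rw [lintegral_const_mul' _ _ ENNReal.coe_ne_top,
          pathELength_eq_lintegral_mfderivWithin_Icc]
    _ ≤ C * r := by gcongr

end RiemannianChart

/-! ### Connected, locally separable metric spaces are separable -/

section Separable

open Set Metric TopologicalSpace

/-- The union of the balls of radius `1 / (2 * (n + 1))` around those points of `s` whose ball of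
radius `1 / (n + 1)` is separable. -/
def separableThickening {M : Type*} [PseudoMetricSpace M] (s : Set M) : Set M :=
  ⋃ n : ℕ, ⋃ x ∈ {x ∈ s | IsSeparable (ball x (1 / ((n : ℝ) + 1)))},
    ball x (1 / (2 * ((n : ℝ) + 1)))

/-- For fixed `n`, choose a countable dense set of admissible centres. Doubling the radius lets the
balls around these cover all the small balls, and each doubled ball is separable. -/
lemma isSeparable_separableThickening {M : Type*} [PseudoMetricSpace M] {s : Set M}
    (hs : IsSeparable s) : IsSeparable (separableThickening s) := by
  refine .iUnion fun n ↦ ?_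
  set A := {x ∈ s | IsSeparable (ball x (1 / ((n : ℝ) + 1)))} with hA
  obtain ⟨D, hDA, hD, hAD⟩ := (hs.mono (sep_subset s _ : A ⊆ s)).exists_countable_dense_subset
  refine IsSeparable.mono (s := ⋃ d ∈ D, ball d (1 / ((n : ℝ) + 1))) ?_ ?_
  · have := hD.to_subtype
    rw [biUnion_eq_iUnion]
    exact .iUnion fun d ↦ (hDA d.2).2
  · refine iUnion₂_subset fun x hx y hy ↦ ?_
    have hpos : (0 : ℝ) < 1 / (2 * ((n : ℝ) + 1)) := by positivity
    obtain ⟨d, hd, hxd⟩ := Metric.mem_closure_iff.1 (hAD hx) _ hpos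
    refine mem_biUnion hd ?_
    rw [mem_ball] at hy ⊢
    have h2 : 1 / ((n : ℝ) + 1) = 1 / (2 * ((n : ℝ) + 1)) + 1 / (2 * ((n : ℝ) + 1)) := by
      field_simp; norm_num
    linarith [dist_triangle y x d]

/-- A connected, locally separable metric space is separable. -/
lemma SeparableSpace.of_locally {M : Type*} [PseudoMetricSpace M] [ConnectedSpace M]
    (h : ∀ x : M, ∃ s ∈ 𝓝 x, IsSeparable s) : SeparableSpace M := by
  obtain ⟨x₀⟩ := (inferInstance : Nonempty M)
  have hball : ∀ x : M, ∃ n : ℕ, IsSeparable (ball x (1 / ((n : ℝ) + 1))) := by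
    intro x
    obtain ⟨s, hs, hsep⟩ := h x
    obtain ⟨ε, hε, hεs⟩ := Metric.mem_nhds_iff.1 hs
    obtain ⟨n, hn⟩ := exists_nat_one_div_lt hε
    exact ⟨n, hsep.mono ((ball_subset_ball hn.le).trans hεs)⟩
  -- Iterated thickenings of one point stay separable; their union is shown to be clopen, hence
  -- everything.
  set S : ℕ → Set M := fun k ↦ separableThickening^[k] {x₀}
  have hS : ∀ k, S (k + 1) = separableThickening (S k) := fun k ↦
    Function.iterate_succ_apply' _ _ _
  have hsub : ∀ k x n, x ∈ S k → IsSeparable (ball x (1 / ((n : ℕ) + 1 : ℝ))) →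
      ball x (1 / (2 * ((n : ℝ) + 1))) ⊆ ⋃ k, S k := by
    intro k x n hx hn
    refine subset_trans ?_ (subset_iUnion S (k + 1))
    rw [hS]
    exact fun y hy ↦ mem_iUnion.2 ⟨n, mem_biUnion (show x ∈ _ from ⟨hx, hn⟩) hy⟩
  have hsep : IsSeparable (⋃ k, S k) := by
    refine .iUnion fun k ↦ ?_
    induction k with
    | zero => exact (finite_singleton x₀).isSeparable
    | succ k ih => rw [hS]; exact isSeparable_separableThickening ih
  have hopen : IsOpen (⋃ k, S k) := by
    refine Metric.isOpen_iff.2 fun x hx ↦ ?_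
    obtain ⟨k, hk⟩ := mem_iUnion.1 hx
    obtain ⟨n, hn⟩ := hball x
    exact ⟨_, by positivity, hsub k x n hk hn⟩
  have hclosed : IsClosed (⋃ k, S k) := by
    refine isClosed_of_closure_subset fun y hy ↦ ?_
    obtain ⟨n, hn⟩ := hball y
    -- With `r = 1/(n+1)`, the index `2n+1` stands for radius `r/2`. If `x` is within `r/4` of `y`,
    -- the `r/2`-ball at `x` lies in the separable `r`-ball at `y`, and `y` lies in the `r/4`-ball
    -- that thickening adds at `x`.
    have hpos : (0 : ℝ) < 1 / (2 * (((2 * n + 1 : ℕ) : ℝ) + 1)) := by positivity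
    obtain ⟨x, hx, hyx⟩ := Metric.mem_closure_iff.1 hy _ hpos
    obtain ⟨k, hk⟩ := mem_iUnion.1 hx
    refine hsub k x (2 * n + 1) hk (hn.mono fun z hz ↦ ?_) hyx
    rw [mem_ball] at hz ⊢
    have h1 : 1 / (((2 * n + 1 : ℕ) : ℝ) + 1) = (1 / ((n : ℝ) + 1)) / 2 := by
      push_cast; field_simp; ring
    have h2 : 1 / (2 * (((2 * n + 1 : ℕ) : ℝ) + 1)) = (1 / ((n : ℝ) + 1)) / 4 := by
      push_cast; field_simp; ring
    have h3 : (0 : ℝ) < 1 / ((n : ℝ) + 1) := by positivity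
    rw [dist_comm] at hyx
    linarith [dist_triangle z x y]
  have huniv : (⋃ k, S k) = univ :=
    IsClopen.eq_univ ⟨hclosed, hopen⟩ ⟨x₀, mem_iUnion.2 ⟨0, mem_singleton _⟩⟩
  rw [huniv] at hsep
  exact isSeparable_univ_iff.1 hsep

end Separable

/-! ### Dyadic grids and deterministic chaining -/

section Chaining

open Set Filter
open scoped ENNReal

variable {ι : Type*}

/-- The half-open unit cube. -/
def unitCube (ι : Type*) : Set (ι → ℝ) := {u | ∀ i, 0 ≤ u i ∧ u i < 1}

/-- Coordinatewise rounding down to a multiple of `2⁻ⁿ`. -/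
noncomputable def dyadicFloor (n : ℕ) (u : ι → ℝ) : ι → ℝ := fun i ↦ ⌊2 ^ n * u i⌋ / 2 ^ n

lemma dyadicFloor_le (n : ℕ) (u : ι → ℝ) (i : ι) : dyadicFloor n u i ≤ u i := by
  rw [dyadicFloor, div_le_iff₀ (by positivity), mul_comm]
  exact Int.floor_le _

lemma lt_dyadicFloor_add (n : ℕ) (u : ι → ℝ) (i : ι) :
    u i < dyadicFloor n u i + (2 ^ n)⁻¹ := by
  have h : (0 : ℝ) < 2 ^ n := by positivity
  rw [dyadicFloor, ← one_div, ← add_div, lt_div_iff₀ h, mul_comm]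
  exact Int.lt_floor_add_one _

lemma dyadicFloor_mem_unitCube (n : ℕ) {u : ι → ℝ} (hu : u ∈ unitCube ι) :
    dyadicFloor n u ∈ unitCube ι := by
  refine fun i ↦ ⟨?_, (dyadicFloor_le n u i).trans_lt (hu i).2⟩
  have : 0 ≤ ⌊2 ^ n * u i⌋ := Int.floor_nonneg.2 (mul_nonneg (by positivity) (hu i).1)
  exact div_nonneg (by exact_mod_cast this) (by positivity)

/-- The grids are nested. Chaining uses this to treat grid points of two successive levels as points
of the finer grid. -/
lemma dyadicFloor_dyadicFloor {k n : ℕ} (h : k ≤ n) (u : ι → ℝ) :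
    dyadicFloor n (dyadicFloor k u) = dyadicFloor k u := by
  obtain ⟨j, rfl⟩ := Nat.exists_eq_add_of_le h
  ext i
  have h2 : (2 : ℝ) ^ (k + j) * dyadicFloor k u i = ((2 ^ j * ⌊2 ^ k * u i⌋ : ℤ) : ℝ) := by
    simp only [dyadicFloor]; push_cast; rw [pow_add]; field_simp
  change (⌊(2 : ℝ) ^ (k + j) * dyadicFloor k u i⌋ : ℝ) / 2 ^ (k + j) = dyadicFloor k u i
  rw [h2, Int.floor_intCast, ← h2]
  field_simp

/-- The pairs of grid points of level `n` which are neighbours, as a family: the first point has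
the coordinates `(j i).1 / 2 ^ n`, and `(j i).2 - 1` is the shift leading to the second. -/
noncomputable def gridNeighbors (n : ℕ) (j : ι → Fin (2 ^ n) × Fin 3) : (ι → ℝ) × (ι → ℝ) :=
  (fun i ↦ (j i).1 / 2 ^ n, fun i ↦ ((j i).1 + (j i).2 - 1) / 2 ^ n)

lemma gridNeighbors_fst_mem_unitCube (n : ℕ) (j : ι → Fin (2 ^ n) × Fin 3) :
    (gridNeighbors n j).1 ∈ unitCube ι := by
  refine fun i ↦ ⟨by simp only [gridNeighbors]; positivity, ?_⟩
  simp only [gridNeighbors]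
  rw [div_lt_one (by positivity)]
  exact_mod_cast (j i).1.2

variable [Fintype ι]

lemma norm_dyadicFloor_sub_le (n : ℕ) (u : ι → ℝ) : ‖dyadicFloor n u - u‖ ≤ (2 ^ n)⁻¹ := by
  refine (pi_norm_le_iff_of_nonneg (by positivity)).2 fun i ↦ ?_
  rw [Pi.sub_apply, Real.norm_eq_abs, abs_le]
  have h1 := dyadicFloor_le n u i
  have h2 := lt_dyadicFloor_add n u i
  have h3 : (0 : ℝ) < (2 ^ n)⁻¹ := by positivity
  constructor <;> linarith

lemma norm_dyadicFloor_sub_dyadicFloor_succ_le (n : ℕ) (u : ι → ℝ) :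
    ‖dyadicFloor n u - dyadicFloor (n + 1) u‖ ≤ (2 ^ (n + 1))⁻¹ := by
  refine (pi_norm_le_iff_of_nonneg (by positivity)).2 fun i ↦ ?_
  have h2 : (0 : ℝ) < 2 ^ n := by positivity
  set t : ℝ := 2 ^ n * u i with ht
  have h1 : (2 : ℝ) ^ (n + 1) * u i = 2 * t := by rw [ht, pow_succ]; ring
  have h3 : dyadicFloor n u i - dyadicFloor (n + 1) u i
      = ((2 * ⌊t⌋ - ⌊2 * t⌋ : ℤ) : ℝ) * (2 ^ (n + 1))⁻¹ := by
    simp only [dyadicFloor]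
    rw [h1, ← ht, pow_succ]; push_cast; field_simp
  rw [Pi.sub_apply, h3, norm_mul, Real.norm_eq_abs, Real.norm_eq_abs, abs_of_pos
    (a := ((2 : ℝ) ^ (n + 1))⁻¹) (by positivity)]
  refine mul_le_of_le_one_left (by positivity) ?_
  have h4 : 2 * ⌊t⌋ ≤ ⌊2 * t⌋ := by
    rw [Int.le_floor]; push_cast; linarith [Int.floor_le t]
  have h5 : ⌊2 * t⌋ < 2 * ⌊t⌋ + 2 := by
    rw [Int.floor_lt]; push_cast; linarith [Int.lt_floor_add_one t]
  have h6 : |2 * ⌊t⌋ - ⌊2 * t⌋| ≤ 1 := by rw [abs_le]; omega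
  exact_mod_cast h6

lemma norm_gridNeighbors_sub_le (n : ℕ) (j : ι → Fin (2 ^ n) × Fin 3) :
    ‖(gridNeighbors n j).1 - (gridNeighbors n j).2‖ ≤ (2 ^ n)⁻¹ := by
  refine (pi_norm_le_iff_of_nonneg (by positivity)).2 fun i ↦ ?_
  have h3 : (gridNeighbors n j).1 i - (gridNeighbors n j).2 i
      = (1 - ((j i).2 : ℕ) : ℝ) * (2 ^ n)⁻¹ := by
    simp only [gridNeighbors]; field_simp; ring
  rw [Pi.sub_apply, h3, norm_mul, Real.norm_eq_abs, Real.norm_eq_abs, abs_of_pos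
    (a := ((2 : ℝ) ^ n)⁻¹) (by positivity)]
  refine mul_le_of_le_one_left (by positivity) ?_
  have h4 : (((j i).2 : ℕ) : ℝ) ≤ 2 := by exact_mod_cast Nat.le_of_lt_succ (j i).2.2
  rw [abs_le]
  constructor <;> linarith [Nat.cast_nonneg (α := ℝ) ((j i).2 : ℕ)]

/-- Reals at distance at most one have floors differing by at most one, so three shifts per
coordinate suffice. -/
lemma exists_gridNeighbors_eq (n : ℕ) {u v : ι → ℝ} (hu : u ∈ unitCube ι)
    (huv : ‖u - v‖ ≤ (2 ^ n)⁻¹) :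
    ∃ j, gridNeighbors n j = (dyadicFloor n u, dyadicFloor n v) := by
  have h2 : (0 : ℝ) < 2 ^ n := by positivity
  have key : ∀ i, ∃ a : Fin (2 ^ n) × Fin 3, ((a.1 : ℕ) : ℝ) = ⌊2 ^ n * u i⌋ ∧
      ((a.1 : ℕ) + (a.2 : ℕ) - 1 : ℝ) = ⌊2 ^ n * v i⌋ := by
    intro i
    have h0 : 0 ≤ ⌊2 ^ n * u i⌋ := Int.floor_nonneg.2 (mul_nonneg (by positivity) (hu i).1)
    have h1 : ⌊2 ^ n * u i⌋ < 2 ^ n := by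
      rw [Int.floor_lt]; push_cast; nlinarith [(hu i).2]
    have h3 : |2 ^ n * u i - 2 ^ n * v i| ≤ 1 := by
      rw [← mul_sub, abs_mul, abs_of_pos h2]
      have := (norm_le_pi_norm (u - v) i).trans huv
      rw [Pi.sub_apply, Real.norm_eq_abs] at this
      calc (2 : ℝ) ^ n * |u i - v i| ≤ 2 ^ n * (2 ^ n)⁻¹ := by gcongr
        _ = 1 := mul_inv_cancel₀ h2.ne'
    rw [abs_le] at h3
    have h4 : ⌊2 ^ n * u i⌋ - 1 ≤ ⌊2 ^ n * v i⌋ := by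
      rw [Int.le_floor]; push_cast; linarith [Int.floor_le (2 ^ n * u i)]
    have h5 : ⌊2 ^ n * v i⌋ < ⌊2 ^ n * u i⌋ + 2 := by
      rw [Int.floor_lt]; push_cast; linarith [Int.lt_floor_add_one (2 ^ n * u i)]
    obtain ⟨a, ha⟩ := Int.eq_ofNat_of_zero_le h0
    obtain ⟨b, hb⟩ := Int.eq_ofNat_of_zero_le
      (show 0 ≤ ⌊2 ^ n * v i⌋ - ⌊2 ^ n * u i⌋ + 1 by omega)
    rw [ha] at h1
    refine ⟨(⟨a, by exact_mod_cast h1⟩, ⟨b, by omega⟩), ?_, ?_⟩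
    · rw [ha]; simp
    · have : (a : ℤ) + b - 1 = ⌊2 ^ n * v i⌋ := by omega
      rw [← this]; push_cast; ring
  choose j hj1 hj2 using key
  refine ⟨j, Prod.ext (funext fun i ↦ ?_) (funext fun i ↦ ?_)⟩
  · simp only [gridNeighbors, dyadicFloor, hj1]
  · simp only [gridNeighbors, dyadicFloor, hj2]

/-- Chaining along the dyadic grids: if the oscillation of `f` over neighbouring grid points is
summable in the level, then `f` extends from the grids with an explicit modulus of continuity. -/
lemma exists_tendsto_dyadicFloor {f : (ι → ℝ) → ℝ} {ε : ℕ → ℝ} {N : ℕ} (hε : Summable ε)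
    (hf : ∀ n ≥ N, ∀ u ∈ unitCube ι, ∀ v ∈ unitCube ι, ‖u - v‖ ≤ (2 ^ n)⁻¹ →
      |f (dyadicFloor n u) - f (dyadicFloor n v)| ≤ ε n) :
    ∃ g : (ι → ℝ) → ℝ,
      (∀ u ∈ unitCube ι, Tendsto (fun n ↦ f (dyadicFloor n u)) atTop (𝓝 (g u))) ∧
      ∀ n ≥ N, ∀ u ∈ unitCube ι, ∀ v ∈ unitCube ι, ‖u - v‖ ≤ (2 ^ n)⁻¹ →
        |g u - g v| ≤ ε n + 2 * ∑' k, ε (n + k + 1) := by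
  have hsum : ∀ n, Summable fun k ↦ ε (n + k + 1) := fun n ↦ by
    have := (summable_nat_add_iff (n + 1)).2 hε
    exact this.congr fun k ↦ by congr 1; ring
  have step : ∀ n ≥ N, ∀ u ∈ unitCube ι, ∀ k,
      dist (f (dyadicFloor (n + k) u)) (f (dyadicFloor (n + (k + 1)) u)) ≤ ε (n + k + 1) := by
    intro n hn u hu k
    -- The hypothesis is applied to the grid points of levels `n+k` and `n+k+1` themselves, both
    -- fixed by rounding at the finer level.
    have := hf (n + k + 1) (by omega) _ (dyadicFloor_mem_unitCube (n + k) hu) _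
      (dyadicFloor_mem_unitCube (n + k + 1) hu) (norm_dyadicFloor_sub_dyadicFloor_succ_le _ _)
    rwa [dyadicFloor_dyadicFloor (Nat.le_succ _), dyadicFloor_dyadicFloor le_rfl] at this
  have hlim : ∀ u ∈ unitCube ι, ∃ a, Tendsto (fun n ↦ f (dyadicFloor n u)) atTop (𝓝 a) := by
    intro u hu
    obtain ⟨a, ha⟩ := cauchySeq_tendsto_of_complete
      (cauchySeq_of_dist_le_of_summable _ (step N le_rfl u hu) (hsum N))
    refine ⟨a, (tendsto_add_atTop_iff_nat N).1 ?_⟩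
    simpa only [add_comm N] using ha
  choose! g hg using hlim
  refine ⟨g, hg, fun n hn u hu v hv huv ↦ ?_⟩
  have tail : ∀ u ∈ unitCube ι, |f (dyadicFloor n u) - g u| ≤ ∑' k, ε (n + k + 1) := by
    intro u hu
    have := dist_le_tsum_of_dist_le_of_tendsto₀ _ (step n hn u hu) (hsum n) (a := g u) (by
      simpa only [add_comm _ n, Function.comp_def] using (tendsto_add_atTop_iff_nat n).2 (hg u hu))
    simpa [Real.dist_eq] using this
  have h1 := tail u hu
  have h2 := tail v hv
  have h3 := hf n hn u hu v hv huv
  rw [abs_le] at *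
  constructor <;> linarith

end Chaining

/-! ### Kolmogorov–Chentsov on the unit cube -/

section Field

open Set Filter
open scoped ENNReal

variable {ι Ω : Type*}

/-- The event that `F` oscillates by more than `ε` over some pair of neighbouring grid points. -/
def oscillationEvent (F : (ι → ℝ) → Ω → ℝ) (ε : ℝ) (n : ℕ) : Set Ω :=
  ⋃ j : {j : ι → Fin (2 ^ n) × Fin 3 // (gridNeighbors n j).2 ∈ unitCube ι},
    {w | ε < |F (gridNeighbors n j.1).1 w - F (gridNeighbors n j.1).2 w|}

lemma measurableSet_oscillationEvent [Finite ι] [MeasurableSpace Ω] {F : (ι → ℝ) → Ω → ℝ}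
    (hF : ∀ u, Measurable (F u)) (ε : ℝ)
    (n : ℕ) : MeasurableSet (oscillationEvent F ε n) :=
  .iUnion fun _ ↦ measurableSet_lt measurable_const ((hF _).sub (hF _)).abs

lemma abs_sub_le_of_notMem_oscillationEvent [Fintype ι] {F : (ι → ℝ) → Ω → ℝ} {ε : ℝ} {n : ℕ} {w : Ω}
    (hw : w ∉ oscillationEvent F ε n) {u v : ι → ℝ} (hu : u ∈ unitCube ι) (hv : v ∈ unitCube ι)
    (huv : ‖u - v‖ ≤ (2 ^ n)⁻¹) :
    |F (dyadicFloor n u) w - F (dyadicFloor n v) w| ≤ ε := by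
  obtain ⟨j, hj⟩ := exists_gridNeighbors_eq n hu huv
  by_contra! h
  refine hw (mem_iUnion.2 ⟨⟨j, ?_⟩, ?_⟩)
  · rw [hj]; exact dyadicFloor_mem_unitCube n hv
  · simpa [hj] using h

variable [Fintype ι] [MeasurableSpace Ω]

/-- Markov's inequality for each pair, then a union bound over at most `(2^n * 3)^card ι` pairs. -/
lemma measure_oscillationEvent_le {P : Measure Ω} {F : (ι → ℝ) → Ω → ℝ}
    (hF : ∀ u, Measurable (F u)) {l ε b : ℝ} (hl : 0 < l) (hε : 0 < ε) {n : ℕ}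
    (h : ∀ u ∈ unitCube ι, ∀ v ∈ unitCube ι, ‖u - v‖ ≤ (2 ^ n)⁻¹ →
      ∫⁻ w, ENNReal.ofReal (|F u w - F v w| ^ l) ∂P ≤ ENNReal.ofReal b) :
    P (oscillationEvent F ε n) ≤
      ENNReal.ofReal (3 ^ Fintype.card ι * (2 ^ (n * Fintype.card ι) * b / ε ^ l)) := by
  classical
  have hεl : 0 < ε ^ l := Real.rpow_pos_of_pos hε l
  have hone : ∀ j : {j : ι → Fin (2 ^ n) × Fin 3 // (gridNeighbors n j).2 ∈ unitCube ι},
      P {w | ε < |F (gridNeighbors n j.1).1 w - F (gridNeighbors n j.1).2 w|}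
        ≤ ENNReal.ofReal (b / ε ^ l) := by
    intro j
    set G : Ω → ℝ≥0∞ := fun w ↦
      ENNReal.ofReal (|F (gridNeighbors n j.1).1 w - F (gridNeighbors n j.1).2 w| ^ l)
    have hG : Measurable G := (((hF _).sub (hF _)).abs.pow_const l).ennreal_ofReal
    calc _ ≤ P {w | ENNReal.ofReal (ε ^ l) ≤ G w} := by
          refine measure_mono fun w hw ↦ ?_
          exact ENNReal.ofReal_le_ofReal (Real.rpow_le_rpow hε.le (le_of_lt hw) hl.le)
      _ ≤ (∫⁻ w, G w ∂P) / ENNReal.ofReal (ε ^ l) :=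
          meas_ge_le_lintegral_div hG.aemeasurable (by simpa using hεl) ENNReal.ofReal_ne_top
      _ ≤ ENNReal.ofReal b / ENNReal.ofReal (ε ^ l) := by
          gcongr
          exact h _ (gridNeighbors_fst_mem_unitCube n j.1) _ j.2 (norm_gridNeighbors_sub_le n j.1)
      _ = _ := (ENNReal.ofReal_div_of_pos hεl).symm
  calc P (oscillationEvent F ε n) ≤ ∑ j, _ := measure_iUnion_fintype_le _ _
    _ ≤ ∑ _j : {j : ι → Fin (2 ^ n) × Fin 3 // (gridNeighbors n j).2 ∈ unitCube ι},
        ENNReal.ofReal (b / ε ^ l) := Finset.sum_le_sum fun j _ ↦ hone j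
    _ ≤ ((2 ^ n * 3) ^ Fintype.card ι : ℕ) * ENNReal.ofReal (b / ε ^ l) := by
        rw [Finset.sum_const, nsmul_eq_mul, Finset.card_univ]
        gcongr
        refine (Fintype.card_subtype_le _).trans ?_
        simp
    _ = _ := by
        rw [← ENNReal.ofReal_natCast, ← ENNReal.ofReal_mul (by positivity)]
        congr 1
        push_cast
        rw [mul_pow, pow_mul]
        ring

/-- Kolmogorov–Chentsov on the unit cube, with a general modulus of continuity. -/
theorem exists_modification_unitCube {P : Measure Ω} {F : (ι → ℝ) → Ω → ℝ}
    (hF : ∀ u, Measurable (F u)) {l : ℝ} (hl : 0 < l) {ε b : ℕ → ℝ} {n₀ : ℕ}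
    (h : ∀ n ≥ n₀, ∀ u ∈ unitCube ι, ∀ v ∈ unitCube ι, ‖u - v‖ ≤ (2 ^ n)⁻¹ →
      ∫⁻ w, ENNReal.ofReal (|F u w - F v w| ^ l) ∂P ≤ ENNReal.ofReal (b n))
    (hε : ∀ n ≥ n₀, 0 < ε n) (hεsum : Summable ε) (hb : Tendsto b atTop (𝓝 0))
    (hsum : Summable fun n ↦ 2 ^ (n * Fintype.card ι) * b n / ε n ^ l) :
    ∃ Ψ : (ι → ℝ) → Ω → ℝ, (∀ u ∈ unitCube ι, Measurable (Ψ u)) ∧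
      (∀ u ∈ unitCube ι, ∀ᵐ w ∂P, Ψ u w = F u w) ∧
      ∀ w, ∃ N, ∀ n ≥ N, ∀ u ∈ unitCube ι, ∀ v ∈ unitCube ι, ‖u - v‖ ≤ (2 ^ n)⁻¹ →
        |Ψ u w - Ψ v w| ≤ ε n + 2 * ∑' k, ε (n + k + 1) := by
  classical
  set G : Set Ω := {w | ∀ᶠ n in atTop, w ∉ oscillationEvent F (ε n) n} with hG
  have hGmeas : MeasurableSet G := by
    have : G = ⋃ N : ℕ, ⋂ n ≥ N, (oscillationEvent F (ε n) n)ᶜ := by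
      ext w; simp [hG, eventually_atTop]
    rw [this]
    exact .iUnion fun N ↦ .iInter fun n ↦ .iInter fun _ ↦
      (measurableSet_oscillationEvent hF _ _).compl
  have hGae : ∀ᵐ w ∂P, w ∈ G := by
    -- Borel–Cantelli, with indices shifted by `n₀` because the moment bounds start there.
    have hfin : ∑' n, P (oscillationEvent F (ε (n + n₀)) (n + n₀)) ≠ ⊤ := by
      have hs := (((summable_nat_add_iff n₀).2 hsum).mul_left
        ((3 : ℝ) ^ Fintype.card ι)).tsum_ofReal_ne_top
      refine ne_top_of_le_ne_top hs (ENNReal.tsum_le_tsum fun n ↦ ?_)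
      exact measure_oscillationEvent_le hF hl (hε _ (Nat.le_add_left _ _))
        (h _ (Nat.le_add_left _ _))
    filter_upwards [ae_eventually_notMem hfin] with w hw
    rw [eventually_atTop] at hw
    obtain ⟨N, hN⟩ := hw
    refine eventually_atTop.2 ⟨N + n₀, fun n hn ↦ ?_⟩
    have := hN (n - n₀) (by omega)
    rwa [Nat.sub_add_cancel (by omega)] at this
  have hpath : ∀ w ∈ G, ∃ g : (ι → ℝ) → ℝ,
      (∀ u ∈ unitCube ι, Tendsto (fun n ↦ F (dyadicFloor n u) w) atTop (𝓝 (g u))) ∧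
      ∃ N, ∀ n ≥ N, ∀ u ∈ unitCube ι, ∀ v ∈ unitCube ι, ‖u - v‖ ≤ (2 ^ n)⁻¹ →
        |g u - g v| ≤ ε n + 2 * ∑' k, ε (n + k + 1) := by
    intro w hw
    obtain ⟨N, hN⟩ := eventually_atTop.1 hw
    obtain ⟨g, hg, hg'⟩ := exists_tendsto_dyadicFloor (f := fun u ↦ F u w) (N := N) hεsum
      fun n hn u hu v hv huv ↦ abs_sub_le_of_notMem_oscillationEvent (hN n hn) hu hv huv
    exact ⟨g, hg, N, hg'⟩
  choose! g hg hg' using hpath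
  refine ⟨fun u ↦ G.indicator fun w ↦ g w u, fun u hu ↦ ?_, fun u hu ↦ ?_, fun w ↦ ?_⟩
  · refine measurable_of_tendsto_metrizable
      (fun n ↦ (hF (dyadicFloor n u)).indicator hGmeas) (tendsto_pi_nhds.2 fun w ↦ ?_)
    by_cases hw : w ∈ G
    · simpa [hw] using hg w hw u hu
    · simp [hw]
  · have hlim : ∀ᵐ w ∂P, Tendsto (fun n ↦ F (dyadicFloor n u) w) atTop (𝓝 (g w u)) := by
      filter_upwards [hGae] with w hw using hg w hw u hu
    have hmeas : ∀ n, Measurable fun w ↦ ENNReal.ofReal (|F (dyadicFloor n u) w - F u w| ^ l) :=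
      fun n ↦ (((hF _).sub (hF _)).abs.pow_const l).ennreal_ofReal
    -- Fatou: the `l`-th moments of `F (dyadicFloor n u) - F u` are at most `b n → 0`, so the almost
    -- sure limit `g w u` must equal `F u w`.
    have hzero : ∫⁻ w, liminf (fun n ↦ ENNReal.ofReal (|F (dyadicFloor n u) w - F u w| ^ l)) atTop
        ∂P = 0 := by
      refine le_antisymm ?_ bot_le
      refine (lintegral_liminf_le hmeas).trans ?_
      have hb' : Tendsto (fun n ↦ ENNReal.ofReal (b n)) atTop (𝓝 0) := by
        simpa using ENNReal.tendsto_ofReal hb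
      rw [← hb'.liminf_eq]
      refine liminf_le_liminf ?_
      filter_upwards [eventually_ge_atTop n₀] with n hn
      exact h n hn _ (dyadicFloor_mem_unitCube n hu) _ hu (norm_dyadicFloor_sub_le n u)
    rw [lintegral_eq_zero_iff (.liminf hmeas)] at hzero
    filter_upwards [hGae, hlim, hzero] with w hw hlim hzero
    have hl2 : Tendsto (fun n ↦ ENNReal.ofReal (|F (dyadicFloor n u) w - F u w| ^ l)) atTop
        (𝓝 (ENNReal.ofReal (|g w u - F u w| ^ l))) :=
      ENNReal.tendsto_ofReal (((hlim.sub_const _).abs).rpow_const (.inr hl.le))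
    have h3 : ENNReal.ofReal (|g w u - F u w| ^ l) = 0 := hl2.liminf_eq.symm.trans hzero
    rw [ENNReal.ofReal_eq_zero] at h3
    have h4 : |g w u - F u w| = 0 :=
      (Real.rpow_eq_zero (abs_nonneg _) hl.ne').1 (le_antisymm h3 (by positivity))
    simpa [hw, sub_eq_zero] using h4
  · by_cases hw : w ∈ G
    · simpa [hw] using hg' w hw
    · refine ⟨n₀, fun n hn u _ v _ _ ↦ ?_⟩
      have : 0 ≤ ∑' k, ε (n + k + 1) := tsum_nonneg fun k ↦ (hε _ (by omega)).le
      simp only [hw, not_false_eq_true, indicator_of_notMem, sub_self, abs_zero]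
      linarith [hε n hn]

end Field

/-! ### Gluing local modifications -/

section Gluing

open Set Filter

/-- Local modifications with continuous paths glue to a global one, up to replacing the paths by
`0` on a null event. -/
lemma exists_isModification_of_local {M Ω : Type*} [TopologicalSpace M]
    [SecondCountableTopology M] [MeasurableSpace Ω] {P : Measure Ω} {φ : M → Ω → ℝ}
    {U : M → Set M} (hU : ∀ z, IsOpen (U z)) (hzU : ∀ z, z ∈ U z) {ψ : M → M → Ω → ℝ}
    (hψ : ∀ z, ∀ x ∈ U z, Measurable (ψ z x))
    (hψφ : ∀ z, ∀ x ∈ U z, ∀ᵐ w ∂P, ψ z x w = φ x w)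
    (hcont : ∀ z w, ContinuousOn (fun x ↦ ψ z x w) (U z)) :
    ∃ Ψ : M → Ω → ℝ, IsModification P Ψ φ ∧ ∃ c : M → M, (∀ z, z ∈ U (c z)) ∧
      ∀ w, (∀ x, Ψ x w = 0) ∨ ∀ z, ∀ x ∈ U (c z), Ψ x w = ψ (c z) x w := by
  obtain ⟨S, hS, hSU⟩ := TopologicalSpace.countable_cover_nhds
    fun z ↦ (hU z).mem_nhds (hzU z)
  obtain ⟨D, hD, hDdense⟩ := TopologicalSpace.exists_countable_dense M
  have hc : ∀ z, ∃ s ∈ S, z ∈ U s := fun z ↦ by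
    simpa using (hSU ▸ mem_univ z : z ∈ ⋃ x ∈ S, U x)
  choose c hcS hcU using hc
  -- Countability of both the cover `S` and the dense set `D` yields a single null event; off it,
  -- continuity extends agreement from `D` to whole overlaps.
  have hae : ∀ᵐ w ∂P, ∀ s ∈ S, ∀ x ∈ D, x ∈ U s → ψ s x w = φ x w := by
    refine (ae_ball_iff hS).2 fun s _ ↦ (ae_ball_iff hD).2 fun x _ ↦ ?_
    by_cases hx : x ∈ U s
    · filter_upwards [hψφ s x hx] with w hw _ using hw
    · exact .of_forall fun w h ↦ absurd h hx
  obtain ⟨t, htsub, ht, ht0⟩ := exists_measurable_superset_of_null (ae_iff.1 hae)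
  have hgood : ∀ w ∈ tᶜ, ∀ s ∈ S, ∀ x ∈ D, x ∈ U s → ψ s x w = φ x w := by
    intro w hw
    by_contra h
    exact hw (htsub h)
  have htae : ∀ᵐ w ∂P, w ∈ tᶜ := by rw [ae_iff]; simpa using ht0
  refine ⟨fun x ↦ tᶜ.indicator (ψ (c x) x),
    ⟨fun x ↦ (hψ _ x (hcU x)).indicator ht.compl, fun x ↦ ?_⟩, c, hcU, fun w ↦ ?_⟩
  · filter_upwards [htae, hψφ _ x (hcU x)] with w hw hw'
    rwa [indicator_of_mem hw]
  · by_cases hw : w ∈ tᶜ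
    · refine .inr fun z x hx ↦ ?_
      have hW : IsOpen (U (c x) ∩ U (c z)) := (hU _).inter (hU _)
      have heq : EqOn (fun x' ↦ ψ (c x) x' w) (fun x' ↦ ψ (c z) x' w)
          (U (c x) ∩ U (c z) ∩ D) := fun x' hx' ↦
        (hgood w hw _ (hcS x) x' hx'.2 hx'.1.1).trans
          (hgood w hw _ (hcS z) x' hx'.2 hx'.1.2).symm
      have := heq.of_subset_closure ((hcont _ w).mono inter_subset_left)
        ((hcont _ w).mono inter_subset_right) inter_subset_left
        (hDdense.open_subset_closure_inter hW) ⟨hcU x, hx⟩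
      exact (indicator_of_mem hw _).trans this
    · exact .inl fun x ↦ indicator_of_notMem hw _

end Gluing

/-! ### The moment bound at dyadic scales -/

section Moment

open Set Filter

/-- At distance at most `L * 2⁻ⁿ` the logarithm is at least `n - log₂ L`, hence at least `n/2` once
`log₂ L ≤ n/2`. Requiring `n₀ ≥ 1` keeps the base `n/2` positive under the negative exponent. -/
lemma MomentBound.exists_le_of_dist_le {M Ω : Type*} [MetricSpace M] [MeasurableSpace Ω]
    {P : Measure Ω} {φ : M → Ω → ℝ} {ρ l K ν κ : ℝ} (h : MomentBound P φ ρ l K ν κ)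
    (hρ : 0 < ρ) (hl : 0 < l) (hK : 0 ≤ K) (hν : 0 ≤ ν) (hκ : 0 ≤ κ) {L : ℝ} (hL : 0 < L) :
    ∃ n₀ ≥ 1, ∀ n : ℕ, n ≥ n₀ → ∀ x y, dist x y ≤ L * (2 ^ n)⁻¹ →
      ∫⁻ w, ENNReal.ofReal (|φ x w - φ y w| ^ l) ∂P ≤
        ENNReal.ofReal (K * ((n : ℝ) / 2) ^ (-ν) * (L * (2 ^ n)⁻¹) ^ κ) := by
  have hlim : Tendsto (fun n : ℕ ↦ L * ((2 : ℝ) ^ n)⁻¹) atTop (𝓝 0) := by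
    have := (tendsto_pow_atTop_nhds_zero_of_lt_one (r := (2 : ℝ)⁻¹) (by norm_num)
      (by norm_num)).const_mul L
    simpa only [inv_pow, mul_zero] using this
  have hlim2 : Tendsto (fun n : ℕ ↦ (n : ℝ) / 2) atTop atTop :=
    tendsto_natCast_atTop_atTop.atTop_div_const (by norm_num)
  obtain ⟨n₀, hn₀⟩ := eventually_atTop.1 ((hlim.eventually_lt_const hρ).and
    (hlim2.eventually_ge_atTop (Real.logb 2 L)))
  refine ⟨n₀ + 1, by omega, fun n hn x y hxy ↦ ?_⟩
  obtain ⟨hn1, hn2⟩ := hn₀ n (by omega)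
  have hnpos : (0 : ℝ) < n := by exact_mod_cast (by omega : 0 < n)
  rcases eq_or_ne x y with rfl | hne
  · simp [Real.zero_rpow hl.ne']
  have hd : 0 < dist x y := dist_pos.2 hne
  refine (h x y (hxy.trans_lt hn1)).trans (ENNReal.ofReal_le_ofReal ?_)
  have hlog : (n : ℝ) / 2 ≤ Real.logb 2 (dist x y)⁻¹ := by
    rw [Real.logb_inv]
    have h1 : Real.logb 2 (dist x y) ≤ Real.logb 2 (L * (2 ^ n)⁻¹) :=
      Real.logb_le_logb_of_le (by norm_num) hd hxy
    rw [Real.logb_mul hL.ne' (by positivity), Real.logb_inv, Real.logb_pow,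
      Real.logb_self_eq_one (by norm_num), mul_one] at h1
    linarith
  gcongr K * ?_ * ?_
  · exact Real.rpow_le_rpow_of_nonpos (by positivity) hlog (by linarith)
  · exact Real.rpow_le_rpow hd.le hxy hκ

end Moment

/-! ### Bi-Lipschitz charts by the unit cube -/

section CubeChart

open Set Filter Metric Manifold
open scoped NNReal ENNReal

variable {E : Type*} [NormedAddCommGroup E] [NormedSpace ℝ E]
  {M : Type*} [MetricSpace M] [ChartedSpace E M]
  [RiemannianBundle (fun x : M ↦ TangentSpace 𝓘(ℝ, E) x)] [IsManifold 𝓘(ℝ, E) 1 M]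
  [IsContinuousRiemannianBundle E (fun x : M ↦ TangentSpace 𝓘(ℝ, E) x)]
  [IsRiemannianManifold 𝓘(ℝ, E) M]

/-- The extended chart at `x` is bi-Lipschitz near `x`. -/
lemma exists_dist_le_dist_extChartAt (x : M) :
    ∃ C : ℝ, 0 < C ∧ ∃ s ∈ 𝓝 x, ∀ y ∈ s, ∀ z ∈ s,
      dist y z ≤ C * dist (extChartAt 𝓘(ℝ, E) x y) (extChartAt 𝓘(ℝ, E) x z) ∧
      dist (extChartAt 𝓘(ℝ, E) x y) (extChartAt 𝓘(ℝ, E) x z) ≤ C * dist y z := by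
  obtain ⟨C₁, s₁, hs₁, h₁⟩ := exists_riemannianEDist_le_edist_extChartAt 𝓘(ℝ, E) x
  obtain ⟨C₂, s₂, hs₂, h₂⟩ := exists_edist_extChartAt_le_edist 𝓘(ℝ, E) x
  refine ⟨C₁ + C₂ + 1, by positivity, _, inter_mem hs₁ hs₂, fun y hy z hz ↦ ⟨?_, ?_⟩⟩
  · have := h₁ y hy.1 z hz.1
    rw [← IsRiemannianManifold.out (I := 𝓘(ℝ, E)), edist_nndist, edist_nndist] at this
    have : dist y z ≤ C₁ * dist (extChartAt 𝓘(ℝ, E) x y) (extChartAt 𝓘(ℝ, E) x z) := by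
      exact_mod_cast this
    refine this.trans (mul_le_mul_of_nonneg_right ?_ dist_nonneg)
    linarith [C₂.coe_nonneg]
  · have := h₂ y hy.2 z hz.2
    rw [edist_nndist, edist_nndist] at this
    have : dist (extChartAt 𝓘(ℝ, E) x y) (extChartAt 𝓘(ℝ, E) x z) ≤ C₂ * dist y z := by
      exact_mod_cast this
    refine this.trans (mul_le_mul_of_nonneg_right ?_ dist_nonneg)
    linarith [C₁.coe_nonneg]

/-- Every point has a neighbourhood which is a bi-Lipschitz image of a part of the unit cube. -/
lemma exists_unitCube_chart {ι : Type*} [Fintype ι] (T : E ≃L[ℝ] (ι → ℝ)) (z : M) :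
    ∃ (U : Set M) (L : ℝ) (p : (ι → ℝ) → M) (q : M → ι → ℝ), IsOpen U ∧ z ∈ U ∧ 0 < L ∧
      (∀ x ∈ U, q x ∈ unitCube ι ∧ p (q x) = x) ∧
      (∀ u ∈ unitCube ι, ∀ v ∈ unitCube ι, dist (p u) (p v) ≤ L * ‖u - v‖) ∧
      ∀ x ∈ U, ∀ y ∈ U, ‖q x - q y‖ ≤ L * dist x y := by
  obtain ⟨C, hC, s, hs, hCs⟩ := exists_dist_le_dist_extChartAt (E := E) z
  set e := extChartAt 𝓘(ℝ, E) z with he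
  obtain ⟨r, hr, hrs⟩ : ∃ r > 0, ball (e z) r ⊆ e.target ∩ e.symm ⁻¹' s :=
    Metric.mem_nhds_iff.1 (inter_mem (extChartAt_target_mem_nhds z)
      (extChartAt_preimage_mem_nhds hs))
  set B := ‖(T.symm : (ι → ℝ) →L[ℝ] E)‖
  set A := ‖(T : E →L[ℝ] (ι → ℝ))‖
  have hB : 0 ≤ B := norm_nonneg _
  have hA : 0 ≤ A := norm_nonneg _
  have hTB : ∀ u, ‖T.symm u‖ ≤ B * ‖u‖ := (T.symm : (ι → ℝ) →L[ℝ] E).le_opNorm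
  have hTA : ∀ u, ‖T u‖ ≤ A * ‖u‖ := (T : E →L[ℝ] (ι → ℝ)).le_opNorm
  -- Cube points are within `1/2` of the centre `h`, so scaling by `δ` keeps their images in the
  -- `r`-ball; the `+ 1` avoids dividing by zero.
  set δ : ℝ := r / (B + 1) with hδ
  have hδpos : 0 < δ := by positivity
  set h : ι → ℝ := fun _ ↦ 1 / 2
  set p' : (ι → ℝ) → E := fun u ↦ e z + δ • T.symm (u - h) with hp'
  set q : M → ι → ℝ := fun x ↦ δ⁻¹ • T (e x - e z) + h with hq
  have hp'mem : ∀ u ∈ unitCube ι, p' u ∈ ball (e z) r := by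
    intro u hu
    have h1 : ‖u - h‖ ≤ 1 / 2 := by
      refine (pi_norm_le_iff_of_nonneg (by norm_num)).2 fun i ↦ ?_
      rw [Pi.sub_apply, Real.norm_eq_abs, abs_le]
      have := hu i
      constructor <;> simp only [h] <;> linarith
    rw [mem_ball, dist_eq_norm, hp', add_sub_cancel_left, norm_smul, Real.norm_of_nonneg hδpos.le]
    calc δ * ‖T.symm (u - h)‖ ≤ δ * (B * (1 / 2)) := by
          gcongr; exact (hTB _).trans (by gcongr)
      _ < δ * (B + 1) := by gcongr; linarith
      _ = r := by rw [hδ]; field_simp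
  have hqz : q z = h := by simp [hq]
  have hcube : unitCube ι ∈ 𝓝 (q z) := by
    have : (univ.pi fun _ : ι ↦ Ioo (0 : ℝ) 1) ∈ 𝓝 (q z) :=
      set_pi_mem_nhds finite_univ fun i _ ↦ by
        rw [hqz]; exact Ioo_mem_nhds (by norm_num [h]) (by norm_num [h])
    exact mem_of_superset this fun u hu i ↦ ⟨(hu i trivial).1.le, (hu i trivial).2⟩
  have hqcont : ContinuousAt q z := by
    have : ContinuousAt e z := continuousAt_extChartAt z
    have hT : ContinuousAt (fun x ↦ T (e x - e z)) z :=
      T.continuous.continuousAt.comp (this.sub continuousAt_const)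
    exact (hT.const_smul δ⁻¹).add continuousAt_const
  obtain ⟨U, hUsub, hU, hzU⟩ := _root_.mem_nhds_iff.1 (inter_mem hs
    (inter_mem (extChartAt_source_mem_nhds (I := 𝓘(ℝ, E)) z) (hqcont.preimage_mem_nhds hcube)))
  have hδ' : 0 ≤ δ⁻¹ := by positivity
  refine ⟨U, C * (δ * B) + δ⁻¹ * A * C + 1, fun u ↦ e.symm (p' u), q, hU, hzU, by positivity,
    fun x hx ↦ ⟨(hUsub hx).2.2, ?_⟩, fun u hu v hv ↦ ?_, fun x hx y hy ↦ ?_⟩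
  · have : p' (q x) = e x := by
      simp [hp', hq, smul_smul, hδpos.ne']
    change e.symm (p' (q x)) = x
    rw [this]
    exact e.left_inv (hUsub hx).2.1
  · have hu' := hrs (hp'mem u hu)
    have hv' := hrs (hp'mem v hv)
    refine ((hCs _ hu'.2 _ hv'.2).1).trans ?_
    rw [e.right_inv hu'.1, e.right_inv hv'.1]
    have : dist (p' u) (p' v) ≤ δ * B * ‖u - v‖ := by
      rw [dist_eq_norm, hp', add_sub_add_left_eq_sub, ← smul_sub, ← map_sub, sub_sub_sub_cancel_right,
        norm_smul, Real.norm_of_nonneg hδpos.le, mul_assoc]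
      gcongr
      exact hTB _
    calc C * dist (p' u) (p' v) ≤ C * (δ * B * ‖u - v‖) := by gcongr
      _ = C * (δ * B) * ‖u - v‖ := by ring
      _ ≤ _ := by
        refine mul_le_mul_of_nonneg_right ?_ (norm_nonneg _)
        linarith [show 0 ≤ δ⁻¹ * A * C by positivity]
  · have : q x - q y = δ⁻¹ • T (e x - e y) := by
      simp only [hq, add_sub_add_right_eq_sub, ← smul_sub, ← map_sub, sub_sub_sub_cancel_right]
    rw [this, norm_smul, Real.norm_of_nonneg hδ']
    have h2 := (hCs x (hUsub hx).1 y (hUsub hy).1).2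
    rw [dist_eq_norm] at h2
    calc δ⁻¹ * ‖T (e x - e y)‖ ≤ δ⁻¹ * (A * (C * dist x y)) := by
          gcongr; exact (hTA _).trans (by gcongr)
      _ = δ⁻¹ * A * C * dist x y := by ring
      _ ≤ _ := by
        refine mul_le_mul_of_nonneg_right ?_ dist_nonneg
        linarith [show 0 ≤ C * (δ * B) by positivity]

end CubeChart

/-! ### From the local theorem to the manifold -/

section Main

open Set Filter Manifold

variable {m : ℕ} {M : Type*} [MetricSpace M] [ChartedSpace (EuclideanSpace ℝ (Fin m)) M]
  [RiemannianBundle (fun x : M ↦ TangentSpace (𝓡 m) x)] [IsManifold (𝓡 m) 1 M]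
  [IsContinuousRiemannianBundle (EuclideanSpace ℝ (Fin m))
    (fun x : M ↦ TangentSpace (𝓡 m) x)]
  [IsRiemannianManifold (𝓡 m) M] {Ω : Type*} [MeasurableSpace Ω] {P : Measure Ω} {φ : M → Ω → ℝ}

/-- Near each point there is a local modification controlled at the dyadic scales. -/
lemma exists_local_modification (hφ : IsRandomField φ) {ρ l K ν κ β : ℝ}
    (h : MomentBound P φ ρ l K ν κ) (hρ : 0 < ρ) (hl : 0 < l) (hK : 0 ≤ K) (hν : 0 < ν)
    (hκ : (m : ℝ) ≤ κ) (hβ : β + 1 < ν) {ε : ℕ → ℝ} (hε : ∀ n ≥ 1, 0 < ε n)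
    (hεsum : Summable ε)
    (hεκ : ∀ n : ℕ, n ≥ 1 → ((2 ^ n)⁻¹ : ℝ) ^ (κ - m) ≤ ε n ^ l * (n : ℝ) ^ β) (z : M) :
    ∃ (U : Set M) (L : ℝ) (ψ : M → Ω → ℝ), IsOpen U ∧ z ∈ U ∧ 0 < L ∧
      (∀ x ∈ U, Measurable (ψ x)) ∧ (∀ x ∈ U, ∀ᵐ w ∂P, ψ x w = φ x w) ∧
      ∀ w, ∃ N, ∀ n ≥ N, ∀ x ∈ U, ∀ y ∈ U, L * dist x y ≤ (2 ^ n)⁻¹ →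
        |ψ x w - ψ y w| ≤ ε n + 2 * ∑' k, ε (n + k + 1) := by
  obtain ⟨U, L, p, q, hU, hzU, hL, hpq, hp, hq⟩ :=
    exists_unitCube_chart (EuclideanSpace.equiv (Fin m) ℝ) z
  have hκ0 : 0 ≤ κ := (Nat.cast_nonneg m).trans hκ
  obtain ⟨n₀, hn₀, hmom⟩ := h.exists_le_of_dist_le hρ hl hK hν.le hκ0 hL
  set b : ℕ → ℝ := fun n ↦ K * ((n : ℝ) / 2) ^ (-ν) * (L * (2 ^ n)⁻¹) ^ κ with hb
  set A : ℝ := K * 2 ^ ν * L ^ κ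
  have hA : 0 ≤ A := by positivity
  have hbeq : ∀ n, b n = A * (n : ℝ) ^ (-ν) * ((2 ^ n)⁻¹ : ℝ) ^ κ := by
    intro n
    simp only [hb, A]
    rw [Real.mul_rpow hL.le (by positivity), Real.div_rpow (by positivity) (by norm_num),
      Real.rpow_neg (by norm_num : (0 : ℝ) ≤ 2), div_inv_eq_mul]
    ring
  have hbzero : Tendsto b atTop (𝓝 0) := by
    have h1 : Tendsto (fun n : ℕ ↦ A * (n : ℝ) ^ (-ν)) atTop (𝓝 0) := by
      simpa using ((tendsto_rpow_neg_atTop hν).comp tendsto_natCast_atTop_atTop).const_mul A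
    refine squeeze_zero (fun n ↦ by rw [hbeq]; positivity) (fun n ↦ ?_) h1
    rw [hbeq]
    refine mul_le_of_le_one_right (by positivity) (Real.rpow_le_one (by positivity) ?_ hκ0)
    exact inv_le_one_of_one_le₀ (one_le_pow₀ (by norm_num))
  have hsum : Summable fun n ↦ 2 ^ (n * Fintype.card (Fin m)) * b n / ε n ^ l := by
    -- The series is dominated by `A * n^(β-ν)`: the pair count `2^(nm)` turns `2^(-nκ)` into
    -- `2^(-n(κ-m))`, which `hεκ` absorbs.
    have hβν := ((Real.summable_nat_rpow (p := -ν + β)).2 (by linarith)).mul_left A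
    refine hβν.of_norm_bounded_eventually_nat ?_
    filter_upwards [eventually_ge_atTop 1] with n hn
    have hεl : 0 < ε n ^ l := Real.rpow_pos_of_pos (hε n hn) l
    have hnpos : (0 : ℝ) < n := by exact_mod_cast hn
    have h2 : (2 : ℝ) ^ (n * m) * ((2 ^ n)⁻¹ : ℝ) ^ κ = ((2 ^ n)⁻¹ : ℝ) ^ (κ - m) := by
      rw [Real.rpow_sub (by positivity), Real.rpow_natCast, pow_mul, inv_pow, div_inv_eq_mul,
        mul_comm]
    rw [Fintype.card_fin, hbeq, Real.norm_of_nonneg (by positivity), div_le_iff₀ hεl,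
      Real.rpow_add hnpos]
    calc (2 : ℝ) ^ (n * m) * (A * (n : ℝ) ^ (-ν) * ((2 ^ n)⁻¹ : ℝ) ^ κ)
        = A * (n : ℝ) ^ (-ν) * ((2 : ℝ) ^ (n * m) * ((2 ^ n)⁻¹ : ℝ) ^ κ) := by ring
      _ ≤ A * (n : ℝ) ^ (-ν) * (ε n ^ l * (n : ℝ) ^ β) := by rw [h2]; gcongr; exact hεκ n hn
      _ = _ := by ring
  obtain ⟨Ψ, hΨm, hΨφ, hΨ⟩ := exists_modification_unitCube (F := fun u ↦ φ (p u))
    (fun u ↦ hφ (p u)) hl (b := b) (fun n hn u hu v hv huv ↦ hmom n hn _ _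
      ((hp u hu v hv).trans (by gcongr))) (fun n hn ↦ hε n (hn₀.trans hn)) hεsum hbzero hsum
  refine ⟨U, L, fun x ↦ Ψ (q x), hU, hzU, hL, fun x hx ↦ hΨm _ (hpq x hx).1, fun x hx ↦ ?_,
    fun w ↦ ?_⟩
  · simpa only [(hpq x hx).2] using hΨφ _ (hpq x hx).1
  · obtain ⟨N, hN⟩ := hΨ w
    exact ⟨N, fun n hn x hx y hy hxy ↦ hN n hn _ (hpq x hx).1 _ (hpq y hy).1
      ((hq x hx y hy).trans hxy)⟩

/-- Second countability is not assumed: local compactness gives separable neighbourhoods, and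
connectedness propagates them. -/
lemma secondCountableTopology_of_connected_manifold {E : Type*} [NormedAddCommGroup E]
    [NormedSpace ℝ E] [FiniteDimensional ℝ E] {X : Type*} [MetricSpace X] [ConnectedSpace X]
    [ChartedSpace E X] : SecondCountableTopology X := by
  have : LocallyCompactSpace X := ChartedSpace.locallyCompactSpace E X
  have : TopologicalSpace.SeparableSpace X := SeparableSpace.of_locally fun x ↦ by
    obtain ⟨s, hs, hx⟩ := exists_compact_mem_nhds x
    exact ⟨s, hx, hs.isSeparable⟩
  exact UniformSpace.secondCountable_of_separable X

/-- A modification whose paths are, near each point, either zero or controlled by the tails of a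
summable series `∑ ε n` at the scales `2⁻ⁿ`. -/
lemma exists_modification [ConnectedSpace M] (hφ : IsRandomField φ) {ρ l K ν κ β : ℝ}
    (h : MomentBound P φ ρ l K ν κ) (hρ : 0 < ρ) (hl : 0 < l) (hK : 0 ≤ K) (hν : 0 < ν)
    (hκ : (m : ℝ) ≤ κ) (hβ : β + 1 < ν) {ε : ℕ → ℝ} (hε : ∀ n ≥ 1, 0 < ε n)
    (hεsum : Summable ε)
    (hεκ : ∀ n : ℕ, n ≥ 1 → ((2 ^ n)⁻¹ : ℝ) ^ (κ - m) ≤ ε n ^ l * (n : ℝ) ^ β) :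
    ∃ Ψ : M → Ω → ℝ, IsModification P Ψ φ ∧ (∀ w, Continuous fun x ↦ Ψ x w) ∧
      ∀ z, ∃ U ∈ 𝓝 z, ∃ L > 0, ∀ w, (∀ x, Ψ x w = 0) ∨
        ∃ N, ∀ n ≥ N, ∀ x ∈ U, ∀ y ∈ U, L * dist x y ≤ (2 ^ n)⁻¹ →
          |Ψ x w - Ψ y w| ≤ ε n + 2 * ∑' k, ε (n + k + 1) := by
  have := secondCountableTopology_of_connected_manifold (E := EuclideanSpace ℝ (Fin m)) (X := M)
  choose U L ψ hU hzU hL hψ hψφ hosc using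
    exists_local_modification hφ h hρ hl hK hν hκ hβ hε hεsum hεκ
  have hmod : Tendsto (fun n ↦ ε n + 2 * ∑' k, ε (n + k + 1)) atTop (𝓝 0) := by
    have h1 := (tendsto_add_atTop_iff_nat 1).2 (tendsto_sum_nat_add ε)
    have h2 := hεsum.tendsto_atTop_zero.add (h1.const_mul 2)
    simp only [mul_zero, add_zero] at h2
    refine h2.congr fun n ↦ ?_
    congr 2
    exact tsum_congr fun k ↦ by congr 1; ring
  have hcont : ∀ z w, ContinuousOn (fun x ↦ ψ z x w) (U z) := by
    intro z w x hx
    obtain ⟨N, hN⟩ := hosc z w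
    refine Metric.continuousWithinAt_iff.2 fun η hη ↦ ?_
    obtain ⟨n, hn, hnN⟩ := ((hmod.eventually_lt_const hη).and (eventually_ge_atTop N)).exists
    have := hL z
    refine ⟨(2 ^ n)⁻¹ / L z, by positivity, fun y hy hyx ↦ ?_⟩
    rw [lt_div_iff₀ this, mul_comm] at hyx
    exact (hN n hnN y hy x hx hyx.le).trans_lt hn
  obtain ⟨Ψ, hΨ, c, hc, hΨc⟩ := exists_isModification_of_local hU hzU hψ hψφ hcont
  refine ⟨Ψ, hΨ, fun w ↦ ?_, fun z ↦ ⟨U (c z), (hU _).mem_nhds (hc z), L (c z), hL _, fun w ↦ ?_⟩⟩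
  · rcases hΨc w with h0 | h1
    · simp only [h0]; exact continuous_const
    · refine continuous_iff_continuousAt.2 fun z ↦ ?_
      refine ((hcont (c z) w).continuousAt ((hU _).mem_nhds (hc z))).congr ?_
      filter_upwards [(hU _).mem_nhds (hc z)] with x hx using (h1 z x hx).symm
  · refine (hΨc w).imp_right fun h1 ↦ ?_
    obtain ⟨N, hN⟩ := hosc (c z) w
    exact ⟨N, fun n hn x hx y hy hxy ↦ by
      rw [h1 z x hx, h1 z y hy]; exact hN n hn x hx y hy hxy⟩

lemma hasLocallyUniformlyContinuousPaths_of_continuous {X Ω : Type*} [MetricSpace X]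
    [WeaklyLocallyCompactSpace X] {Ψ : X → Ω → ℝ} (h : ∀ w, Continuous fun x ↦ Ψ x w) :
    HasLocallyUniformlyContinuousPaths Ψ := fun w z ↦ by
  obtain ⟨s, hs, hz⟩ := exists_compact_mem_nhds z
  exact ⟨s, hz, hs.uniformContinuousOn_of_continuous (h w).continuousOn⟩

/-- The Hölder bound obtained from a control at the dyadic scales. -/
lemma abs_sub_le_of_dyadic {X : Type*} [MetricSpace X] {f : X → ℝ} {U : Set X} {L A γ : ℝ}
    {N : ℕ} (hL : 0 < L) (hA : 0 ≤ A) (hγ : 0 < γ)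
    (h : ∀ n ≥ N, ∀ x ∈ U, ∀ y ∈ U, L * dist x y ≤ (2 ^ n)⁻¹ →
      |f x - f y| ≤ A * ((2 ^ n)⁻¹ : ℝ) ^ γ) {x y : X} (hx : x ∈ U) (hy : y ∈ U)
    (hxy : L * dist x y < (2 ^ N)⁻¹) :
    |f x - f y| ≤ A * (2 * L) ^ γ * dist x y ^ γ := by
  rcases eq_or_ne x y with rfl | hne
  · simp [Real.zero_rpow hγ.ne']
  have hd : 0 < dist x y := dist_pos.2 hne
  -- Choose `n` with `2^(-(n+1)) < L d ≤ 2^(-n)`; then `2^(-n) < 2 L d`, the source of the factor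
  -- `(2L)^γ`.
  obtain ⟨n, hn1, hn2⟩ := exists_nat_pow_near_of_lt_one (x := L * dist x y) (y := (2 : ℝ)⁻¹)
    (by positivity) (hxy.le.trans (inv_le_one_of_one_le₀ (one_le_pow₀ (by norm_num))))
    (by norm_num) (by norm_num)
  rw [inv_pow] at hn1 hn2
  have hN : N ≤ n := by
    by_contra! hlt
    have h1 := hn1.trans hxy
    rw [inv_lt_inv₀ (by positivity) (by positivity)] at h1
    have := (pow_lt_pow_iff_right₀ (by norm_num : (1 : ℝ) < 2)).1 h1
    omega
  refine (h n hN x hx y hy hn2).trans ?_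
  rw [mul_assoc, ← Real.mul_rpow (by positivity) hd.le]
  gcongr
  rw [pow_succ, mul_inv] at hn1
  linarith

end Main

theorem mainTheorem3 (m : ℕ)
    {M : Type*} [MetricSpace M] [ConnectedSpace M]
    [ChartedSpace (EuclideanSpace ℝ (Fin m)) M] [IsManifold (𝓡 m) ∞ M]
    [RiemannianBundle (fun x : M ↦ TangentSpace (𝓡 m) x)]
    [IsContMDiffRiemannianBundle (𝓡 m) ∞ (EuclideanSpace ℝ (Fin m))
      (fun x : M ↦ TangentSpace (𝓡 m) x)]
    [IsRiemannianManifold (𝓡 m) M]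
    {Ω : Type*} [MeasurableSpace Ω] (P : Measure Ω) [IsProbabilityMeasure P]
    (φ : M → Ω → ℝ) (hφ : IsRandomField φ) :
    (∀ ρ l κ ν K : ℝ, 0 < ρ → ρ ≤ 1 → 1 ≤ l → (m : ℝ) ≤ κ → l + 1 < ν → 0 < K →
      MomentBound P φ ρ l K ν κ →
      ∃ ψ : M → Ω → ℝ, IsModification P ψ φ ∧ HasLocallyUniformlyContinuousPaths ψ) ∧
    (∀ ρ l γ α K : ℝ, 0 < ρ → ρ ≤ 1 → 1 ≤ l → 0 < γ → γ < 1 → 1 < α → 0 < K →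
      MomentBound P φ ρ l K α ((m : ℝ) + l * γ) →
      ∃ ψ : M → Ω → ℝ, IsModification P ψ φ ∧ HasLocallyHolderPaths γ ψ) := by
  have hman : IsManifold (𝓡 m) 1 M := .of_le (n := ∞) (by norm_num)
  have hcontB : IsContinuousRiemannianBundle (EuclideanSpace ℝ (Fin m))
      (fun x : M ↦ TangentSpace (𝓡 m) x) := by
    obtain ⟨g, hg, hgi⟩ := IsContMDiffRiemannianBundle.exists_contMDiff (IB := 𝓡 m) (n := ∞)
      (F := EuclideanSpace ℝ (Fin m)) (E := fun x : M ↦ TangentSpace (𝓡 m) x)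
    exact ⟨g, hg.continuous, hgi⟩
  constructor
  · intro ρ l κ ν K hρ _ hl hκ hν hK h
    have : LocallyCompactSpace M := ChartedSpace.locallyCompactSpace (EuclideanSpace ℝ (Fin m)) M
    have hl0 : 0 < l := by linarith
    -- `a * l` is the midpoint of `l` and `ν - 1`, which gives both `1 < a` and `a * l + 1 < ν`.
    set a : ℝ := (ν - 1 + l) / (2 * l) with ha
    have hal : a * l = (ν - 1 + l) / 2 := by rw [ha]; field_simp
    have ha1 : 1 < a := by rw [ha, lt_div_iff₀ (by positivity)]; linarith
    obtain ⟨ψ, hψ, hcont, -⟩ := exists_modification hφ h hρ hl0 hK.le (by linarith) hκ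
      (β := a * l) (by linarith) (ε := fun n : ℕ ↦ (n : ℝ) ^ (-a))
      (fun n hn ↦ Real.rpow_pos_of_pos (by exact_mod_cast hn) _)
      (Real.summable_nat_rpow.2 (by linarith)) (fun n hn ↦ by
        have hn0 : (0 : ℝ) < n := by exact_mod_cast hn
        rw [← Real.rpow_mul hn0.le, ← Real.rpow_add hn0, neg_mul, neg_add_cancel, Real.rpow_zero]
        exact Real.rpow_le_one (by positivity)
          (inv_le_one_of_one_le₀ (one_le_pow₀ (by norm_num))) (by linarith))
    exact ⟨ψ, hψ, hasLocallyUniformlyContinuousPaths_of_continuous hcont⟩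
  · intro ρ l γ α K hρ _ hl hγ _ hα hK h
    have hl0 : 0 < l := by linarith
    set θ : ℝ := (2⁻¹ : ℝ) ^ γ with hθ
    have hθ0 : 0 < θ := by positivity
    have hθ1 : θ < 1 := Real.rpow_lt_one (by norm_num) (by norm_num) hγ
    have hθpow : ∀ n : ℕ, θ ^ n = ((2 ^ n)⁻¹ : ℝ) ^ γ := fun n ↦ by
      rw [hθ, ← Real.rpow_natCast, ← Real.rpow_mul (by norm_num), mul_comm,
        Real.rpow_mul (by norm_num), Real.rpow_natCast, inv_pow]
    -- Here `κ - m = l * γ`, so `θ^n = 2^(-nγ)` meets the condition with equality and `β = 0`;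
    -- summability then rests on `α > 1` alone.
    obtain ⟨ψ, hψ, -, hosc⟩ := exists_modification hφ h hρ hl0 hK.le (by linarith)
      (by linarith [mul_pos hl0 hγ])
      (β := 0) (by linarith) (ε := fun n : ℕ ↦ θ ^ n) (fun n _ ↦ by positivity)
      (summable_geometric_of_lt_one hθ0.le hθ1) (fun n _ ↦ by
        rw [hθpow, ← Real.rpow_mul (by positivity), add_sub_cancel_left, Real.rpow_zero, mul_one,
          mul_comm l])
    refine ⟨ψ, hψ, fun z ↦ ?_⟩
    obtain ⟨U, hU, L, hL, hUL⟩ := hosc z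
    -- Factoring `θ^n` out of the geometric modulus leaves `A`, which depends only on `γ`.
    set A : ℝ := 1 + 2 * ∑' k, θ ^ (k + 1) with hA
    have hA0 : 0 ≤ A := by
      have : 0 ≤ ∑' k, θ ^ (k + 1) := tsum_nonneg fun k ↦ by positivity
      linarith
    refine ⟨A * (2 * L) ^ γ, fun w ↦ ?_⟩
    rcases hUL w with h0 | ⟨N, hN⟩
    · refine ⟨Set.univ, Filter.univ_mem, fun x _ y _ ↦ ?_⟩
      rw [h0, h0, sub_zero, abs_zero]
      positivity
    -- Two points of this ball satisfy `L * dist x y < 2^(-N)`. The level `N` depends on the path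
    -- and affects only the neighbourhood.
    · have hr : (0 : ℝ) < (2 ^ N)⁻¹ / (2 * L) := by positivity
      refine ⟨_, Filter.inter_mem hU (Metric.ball_mem_nhds z hr), fun x hx y hy ↦ ?_⟩
      refine abs_sub_le_of_dyadic (f := fun x ↦ ψ x w) (N := N) hL hA0 hγ
        (fun n hn x hx y hy hxy ↦ ?_) hx.1 hy.1 ?_
      · refine (hN n hn x hx y hy hxy).trans_eq ?_
        rw [← hθpow, hA, add_mul, one_mul, mul_assoc, ← tsum_mul_right]
        congr 2
        exact tsum_congr fun k ↦ by ring
      · have h1 := Metric.mem_ball.1 hx.2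
        have h2 := Metric.mem_ball'.1 hy.2
        rw [lt_div_iff₀ (by positivity)] at h1 h2
        nlinarith [mul_le_mul_of_nonneg_left (dist_triangle x z y) hL.le]
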